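/- Let $E$ be a set and let $S=\mathbb{R}_+^E$ be the space of all functions $E\to\mathbb{R}_+=[0,\infty)$ with its cylindrical $\sigma$-algebra. Let $\mathcal{M}(S)$ be the space of finite measures on $S$, with the $\sigma$-algebra generated by the maps $\mu\mapsto\mu(A)$, $A\subset S$ measurable. Let $N$ be a Poisson random measure on $S$ with intensity $\nu$, where $\nu$ is a measure on $S$ (not necessarily finite): $N$ is a random measure such that $N(A)$ is Poisson distributed with mean $\nu(A)$ for every measurable $A$ (with $N(A)=\infty$ a.s. if $\nu(A)=\infty$), and $N(A_1),\dots,N(A_n)$ are independent whenever $A_1,\dots,A_n$ are measurable and pairwise disjoint. Let $\lambda$ be the Lévy measure of $N$ as an infinitely divisible random measure, that is, $\lambda$ is a measure on $\mathcal{M}(S)$ with $\lambda(\{0\})=0$ for which there is a non-random $m\in\mathcal{M}(S)$ (the drift) such that, for all $n\ge 0$, all measurable $A_1,\dots,A_n\subset S$ and all $\alpha_1,\dots,\alpha_n\ge 0$, \[ \mathbb{E}\Big[e^{-\sum_{i=1}^n\alpha_i N(A_i)}\Big]=\exp\Big\{-\sum_{i=1}^n\alpha_i m(A_i)-\int_{\mathcal{M}(S)}\Big(1-e^{-\sum_{i=1}^n\alpha_i\mu(A_i)}\Big)\,\lambda(d\mu)\Big\}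 \] (with $e^{-\infty}=0$ and $0\cdot\infty=0$). Then \[ \nu=\int_{\mathcal{M}(S)}\mu\,\lambda(d\mu), \] that is, $\nu(A)=\int_{\mathcal{M}(S)}\mu(A)\,\lambda(d\mu)$ for every measurable $A\subset S$. -/

import Mathlib

open MeasureTheory ProbabilityTheory
open scoped ENNReal NNReal

/-- The space `M(S)` of finite measures on a measurable space `S`. As a subtype of `Measure S` it
carries the σ-algebra generated by the evaluations `μ ↦ μ A`, `A` measurable. -/
abbrev FinMeas (S : Type*) [MeasurableSpace S] : Type _ :=
  {μ : Measure S // IsFiniteMeasure μ}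

/-- `t ↦ exp (-t)` on `[0, ∞]`, with `exp (-∞) = 0`. -/
noncomputable def expNeg (t : ℝ≥0∞) : ℝ≥0∞ := EReal.exp (-(t : EReal))

/-- The Poisson distribution with mean `t ∈ [0, ∞]`, as a law on `[0, ∞]`
(the point mass at `∞` when `t = ∞`). -/
noncomputable def poissonLaw (t : ℝ≥0∞) : Measure ℝ≥0∞ :=
  if t = ∞ then Measure.dirac ∞
  else (poissonMeasure t.toNNReal).map (fun n : ℕ => (n : ℝ≥0∞))

/-- `N` is a Poisson random measure on `S` with intensity `ν`: a measurable map into the measures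
on `S` such that `N A` has the Poisson distribution with mean `ν A` for every measurable `A`, and
`N (A 1), …, N (A n)` are independent for pairwise disjoint measurable `A 1, …, A n`. -/
structure IsPoissonRandomMeasure {Ω S : Type*} [MeasurableSpace Ω] [MeasurableSpace S]
    (P : Measure Ω) (N : Ω → Measure S) (ν : Measure S) : Prop where
  measurable : Measurable N
  law : ∀ A : Set S, MeasurableSet A → P.map (fun ω => N ω A) = poissonLaw (ν A)
  indep : ∀ (n : ℕ) (A : Fin n → Set S), (∀ i, MeasurableSet (A i)) →
    Pairwise (fun i j => Disjoint (A i) (A j)) → iIndepFun (fun i ω => N ω (A i)) P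

/-- `lam` is the Lévy measure of the (infinitely divisible) random measure `ξ` on `S`: a measure on
`M(S)` without mass at the zero measure such that, for some non-random drift `m ∈ M(S)`, all the
vectors `(ξ (A 1), …, ξ (A n))` have the Laplace transform
`E[exp (-∑ αᵢ ξ(Aᵢ))] = exp (-∑ αᵢ m(Aᵢ) - ∫ (1 - exp (-∑ αᵢ μ(Aᵢ))) lam(dμ))`. -/
structure IsLevyMeasure {Ω S : Type*} [MeasurableSpace Ω] [MeasurableSpace S]
    (P : Measure Ω) (ξ : Ω → Measure S) (lam : Measure (FinMeas S)) : Prop where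
  zero : lam {μ | μ.1 = 0} = 0
  laplace : ∃ m : FinMeas S, ∀ (n : ℕ) (A : Fin n → Set S) (α : Fin n → ℝ≥0),
    (∀ i, MeasurableSet (A i)) →
      ∫⁻ ω, expNeg (∑ i, α i * ξ ω (A i)) ∂P
        = expNeg (∑ i, α i * m.1 (A i)
            + ∫⁻ μ : FinMeas S, (1 - expNeg (∑ i, α i * μ.1 (A i))) ∂lam)

open Filter
open scoped Topology

/-!
The Laplace transforms of `N A` computed from its Poisson law and from the Lévy measure have equal
exponents: with `d` the drift of `A`,
`ν A * (1 - e⁻ᵃ) = a * d + ∫ (1 - exp (-a * μ A)) lam(dμ)` for all `a ≥ 0`.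
Dividing by `a` and letting `a → 0` gives `ν A = d + ∫ μ A lam(dμ)`. If `ν A = ∞`, the integral is
infinite because `d` is finite; if `ν A < ∞`, the left-hand side of the identity stays bounded as
`a → ∞`, which forces `d = 0`.
-/

lemma expNeg_coe (x : ℝ≥0) : expNeg x = ENNReal.ofReal (Real.exp (-x)) := rfl

lemma expNeg_injective : Function.Injective expNeg := fun _ _ h =>
  EReal.coe_ennreal_injective (neg_injective (EReal.exp_strictMono.injective h))

lemma measurable_expNeg : Measurable expNeg :=
  EReal.measurable_exp.comp measurable_coe_ennreal_ereal.neg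

@[simp] lemma expNeg_zero : expNeg 0 = 1 := by simp [expNeg]

@[simp] lemma expNeg_top : expNeg ∞ = 0 := by simp [expNeg]

lemma expNeg_le_one (x : ℝ≥0∞) : expNeg x ≤ 1 := by
  simp [expNeg, EReal.coe_ennreal_nonneg x]

lemma expNeg_mul_natCast (x : ℝ≥0∞) (n : ℕ) : expNeg (x * n) = expNeg x ^ n := by
  rw [expNeg, expNeg, ← EReal.exp_nmul, EReal.coe_ennreal_mul, mul_comm, ← mul_neg]
  rfl

lemma one_sub_expNeg_coe (x : ℝ≥0) : 1 - expNeg x = ENNReal.ofReal (1 - Real.exp (-x)) := by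
  rw [expNeg_coe, ENNReal.ofReal_sub _ (Real.exp_pos _).le, ENNReal.ofReal_one]

lemma one_sub_expNeg_ne_zero {x : ℝ≥0∞} (hx : x ≠ 0) : 1 - expNeg x ≠ 0 := by
  have hlt : expNeg x < 1 :=
    (expNeg_le_one x).lt_of_ne fun h => hx (expNeg_injective (h.trans expNeg_zero.symm))
  exact (tsub_pos_of_lt hlt).ne'

lemma one_sub_expNeg_le (x : ℝ≥0∞) : 1 - expNeg x ≤ x := by
  induction x with
  | top => exact le_top
  | coe x =>
    rw [one_sub_expNeg_coe, ← ENNReal.ofReal_coe_nnreal]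
    exact ENNReal.ofReal_le_ofReal (by linarith [Real.one_sub_le_exp_neg (x : ℝ)])

lemma inv_mul_one_sub_expNeg_mul_le (a : ℝ≥0) (x : ℝ≥0∞) :
    (a : ℝ≥0∞)⁻¹ * (1 - expNeg (a * x)) ≤ x := by
  obtain rfl | ha := eq_or_ne a 0
  · simp
  calc (a : ℝ≥0∞)⁻¹ * (1 - expNeg (a * x)) ≤ (a : ℝ≥0∞)⁻¹ * (a * x) := by
        gcongr; exact one_sub_expNeg_le _
    _ = x := ENNReal.inv_mul_cancel_left (by simpa using ha) ENNReal.coe_ne_top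

lemma tendsto_inv_mul_one_sub_expNeg_mul (x : ℝ≥0∞) :
    Tendsto (fun a : ℝ≥0 => (a : ℝ≥0∞)⁻¹ * (1 - expNeg (a * x))) (𝓝[>] 0) (𝓝 x) := by
  induction x with
  | top =>
    have hinv : Tendsto (fun a : ℝ≥0 => (a : ℝ≥0∞)⁻¹) (𝓝[>] 0) (𝓝 ∞) := by
      rw [← ENNReal.inv_zero, tendsto_inv_iff]
      exact ENNReal.tendsto_coe.2 (tendsto_id.mono_left nhdsWithin_le_nhds)
    refine hinv.congr' ?_
    filter_upwards [self_mem_nhdsWithin] with a ha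
    have ha0 : (a : ℝ≥0∞) ≠ 0 := by simpa using ha.ne'
    rw [ENNReal.mul_top ha0, expNeg_top, tsub_zero, mul_one]
  | coe x =>
    have hderiv : HasDerivAt (fun t : ℝ => 1 - Real.exp (-(t * x))) x 0 := by
      simpa using (((hasDerivAt_id (0 : ℝ)).mul_const (x : ℝ)).neg.exp).const_sub 1
    have hcoe : Tendsto ((↑) : ℝ≥0 → ℝ) (𝓝[>] 0) (𝓝[>] 0) :=
      tendsto_nhdsWithin_iff.2 ⟨(NNReal.continuous_coe.tendsto 0).mono_left nhdsWithin_le_nhds,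
        eventually_mem_nhdsWithin.mono fun _ ha => NNReal.coe_pos.2 ha⟩
    have hslope := ENNReal.tendsto_ofReal (hderiv.tendsto_slope_zero_right.comp hcoe)
    rw [ENNReal.ofReal_coe_nnreal] at hslope
    refine hslope.congr' ?_
    filter_upwards [self_mem_nhdsWithin] with a ha
    rw [← ENNReal.coe_mul, one_sub_expNeg_coe, ← ENNReal.coe_inv ha.ne']
    simp [ENNReal.ofReal_mul, ← ENNReal.ofReal_coe_nnreal]

lemma tendsto_lintegral_of_tendsto_of_le {X ι : Type*} [MeasurableSpace X] {κ : Measure X}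
    {l : Filter ι} [l.IsCountablyGenerated] {F : ι → X → ℝ≥0∞} {f : X → ℝ≥0∞}
    (hF : ∀ i, Measurable (F i)) (hle : ∀ i x, F i x ≤ f x)
    (hlim : ∀ x, Tendsto (fun i => F i x) l (𝓝 (f x))) :
    Tendsto (fun i => ∫⁻ x, F i x ∂κ) l (𝓝 (∫⁻ x, f x ∂κ)) := by
  obtain rfl | _ := l.eq_or_neBot
  · exact tendsto_bot
  refine tendsto_of_le_liminf_of_limsup_le ?_ ?_
  · calc ∫⁻ x, f x ∂κ = ∫⁻ x, liminf (fun i => F i x) l ∂κ :=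
          lintegral_congr fun x => (hlim x).liminf_eq.symm
      _ ≤ liminf (fun i => ∫⁻ x, F i x ∂κ) l := lintegral_liminf_le hF
  · exact limsup_le_of_le (h := .of_forall fun i => lintegral_mono (hle i))

lemma lintegral_pow_poissonMeasure (t : ℝ≥0) {z : ℝ≥0∞} (hz : z ≤ 1) :
    ∫⁻ n, z ^ n ∂poissonMeasure t = expNeg (t * (1 - z)) := by
  lift z to ℝ≥0 using ne_top_of_le_ne_top ENNReal.one_ne_top hz
  have hz1 : z ≤ 1 := by exact_mod_cast hz
  have hseries : HasSum (fun n : ℕ => Real.exp (-t) * ((t * z : ℝ) ^ n / n.factorial))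
      (Real.exp (-(t * (1 - z)))) := by
    have h := (NormedSpace.expSeries_div_hasSum_exp (t * z : ℝ)).mul_left (Real.exp (-t))
    rwa [← Real.exp_eq_exp_ℝ, ← Real.exp_add,
      show -(t : ℝ) + t * z = -(t * (1 - z)) by ring] at h
  calc ∫⁻ n, (z : ℝ≥0∞) ^ n ∂poissonMeasure t
      = ∑' n : ℕ, ENNReal.ofReal (Real.exp (-t) * ((t * z : ℝ) ^ n / n.factorial)) := by
        rw [lintegral_countable']
        refine tsum_congr fun n => ?_
        rw [poissonMeasure_singleton, ← ENNReal.coe_pow, ← ENNReal.ofReal_coe_nnreal,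
          ← ENNReal.ofReal_mul (by positivity), NNReal.coe_pow]
        ring_nf
    _ = ENNReal.ofReal (Real.exp (-(t * (1 - z)))) := by
        rw [← ENNReal.ofReal_tsum_of_nonneg (fun n => by positivity) hseries.summable,
          hseries.tsum_eq]
    _ = expNeg (t * (1 - z)) := by
        rw [← ENNReal.coe_one, ← ENNReal.coe_sub, ← ENNReal.coe_mul, expNeg_coe, NNReal.coe_mul,
          NNReal.coe_sub hz1, NNReal.coe_one]

lemma lintegral_expNeg_mul_poissonLaw (a t : ℝ≥0∞) :
    ∫⁻ x, expNeg (a * x) ∂poissonLaw t = expNeg (t * (1 - expNeg a)) := by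
  have hmeas : Measurable fun x : ℝ≥0∞ => expNeg (a * x) :=
    measurable_expNeg.comp (measurable_id.const_mul a)
  induction t with
  | top =>
    rw [poissonLaw, if_pos rfl, lintegral_dirac' _ hmeas]
    obtain rfl | ha := eq_or_ne a 0
    · simp
    · rw [ENNReal.mul_top ha, ENNReal.top_mul (one_sub_expNeg_ne_zero ha)]
  | coe t =>
    rw [poissonLaw, if_neg ENNReal.coe_ne_top, ENNReal.toNNReal_coe,
      lintegral_map hmeas .of_discrete]
    simp only [expNeg_mul_natCast]
    exact lintegral_pow_poissonMeasure t (expNeg_le_one a)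

section LaplaceExponent

variable {X : Type*} [MeasurableSpace X] {κ : Measure X} {f : X → ℝ≥0∞} {t d : ℝ≥0∞}

lemma tendsto_inv_mul_lintegral_one_sub_expNeg (hf : Measurable f) :
    Tendsto (fun a : ℝ≥0 => (a : ℝ≥0∞)⁻¹ * ∫⁻ x, (1 - expNeg (a * f x)) ∂κ) (𝓝[>] 0)
      (𝓝 (∫⁻ x, f x ∂κ)) := by
  have hmeas (a : ℝ≥0) : Measurable fun x => 1 - expNeg (a * f x) :=
    measurable_const.sub (measurable_expNeg.comp (hf.const_mul _))
  simp only [← lintegral_const_mul _ (hmeas _)]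
  exact tendsto_lintegral_of_tendsto_of_le (fun a => (hmeas a).const_mul _)
    (fun a x => inv_mul_one_sub_expNeg_mul_le a (f x))
    (fun x => tendsto_inv_mul_one_sub_expNeg_mul (f x))

lemma eq_drift_add_lintegral_of_laplaceExponent_eq (hf : Measurable f)
    (h : ∀ a : ℝ≥0, t * (1 - expNeg a) = a * d + ∫⁻ x, (1 - expNeg (a * f x)) ∂κ) :
    t = d + ∫⁻ x, f x ∂κ := by
  have hleft : Tendsto (fun a : ℝ≥0 => t * ((a : ℝ≥0∞)⁻¹ * (1 - expNeg a))) (𝓝[>] 0) (𝓝 t) := by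
    simpa using ENNReal.Tendsto.const_mul (a := t) (tendsto_inv_mul_one_sub_expNeg_mul 1)
      (.inl one_ne_zero)
  have hright := (tendsto_inv_mul_lintegral_one_sub_expNeg (κ := κ) hf).const_add d
  refine tendsto_nhds_unique (hleft.congr' ?_) hright
  filter_upwards [self_mem_nhdsWithin] with a ha
  rw [mul_left_comm, h, mul_add,
    ENNReal.inv_mul_cancel_left (by simpa using ha.ne') ENNReal.coe_ne_top]

lemma drift_eq_zero_of_laplaceExponent_eq (ht : t ≠ ∞)
    (h : ∀ a : ℝ≥0, t * (1 - expNeg a) = a * d + ∫⁻ x, (1 - expNeg (a * f x)) ∂κ) : d = 0 := by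
  by_contra hd
  obtain ⟨n, hn⟩ := ENNReal.exists_nat_mul_gt hd ht
  refine hn.not_ge ?_
  calc (n : ℝ≥0∞) * d ≤ t * (1 - expNeg (n : ℝ≥0)) := by
        rw [h, ENNReal.coe_natCast]; exact le_self_add
    _ ≤ t := mul_le_of_le_one_right' tsub_le_self

lemma lintegral_eq_of_laplaceExponent_eq (hf : Measurable f) (hd : d ≠ ∞)
    (h : ∀ a : ℝ≥0, t * (1 - expNeg a) = a * d + ∫⁻ x, (1 - expNeg (a * f x)) ∂κ) :
    ∫⁻ x, f x ∂κ = t := by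
  have hmean := eq_drift_add_lintegral_of_laplaceExponent_eq hf h
  obtain rfl | ht := eq_or_ne t ∞
  · exact (ENNReal.add_eq_top.1 hmean.symm).resolve_left hd
  · rw [hmean, drift_eq_zero_of_laplaceExponent_eq ht h, zero_add]

end LaplaceExponent

section RandomMeasure

variable {Ω S : Type*} [MeasurableSpace Ω] [MeasurableSpace S] {P : Measure Ω}
  {N : Ω → Measure S} {lam : Measure (FinMeas S)}

lemma IsLevyMeasure.exists_laplace_apply (hlam : IsLevyMeasure P N lam) :
    ∃ m : FinMeas S, ∀ A, MeasurableSet A → ∀ a : ℝ≥0,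
      ∫⁻ ω, expNeg (a * N ω A) ∂P
        = expNeg (a * m.1 A + ∫⁻ μ : FinMeas S, (1 - expNeg (a * μ.1 A)) ∂lam) := by
  obtain ⟨m, hm⟩ := hlam.laplace
  refine ⟨m, fun A hA a => ?_⟩
  simpa only [Fin.sum_univ_one] using hm 1 (fun _ => A) (fun _ => a) fun _ => hA

theorem mainTheorem9_general {ν : Measure S} (hN : Measurable N)
    (hlaw : ∀ A, MeasurableSet A → P.map (fun ω => N ω A) = poissonLaw (ν A)) (m : FinMeas S)
    (hlaplace : ∀ A, MeasurableSet A → ∀ a : ℝ≥0,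
      ∫⁻ ω, expNeg (a * N ω A) ∂P
        = expNeg (a * m.1 A + ∫⁻ μ : FinMeas S, (1 - expNeg (a * μ.1 A)) ∂lam)) :
    ν = lam.bind (fun μ => μ.1) := by
  have := m.2
  ext A hA
  rw [Measure.bind_apply hA measurable_subtype_coe.aemeasurable]
  refine (lintegral_eq_of_laplaceExponent_eq
    ((Measure.measurable_coe hA).comp measurable_subtype_coe) (measure_ne_top m.1 A)
    fun a => expNeg_injective ?_).symm
  calc expNeg (ν A * (1 - expNeg a))
      = ∫⁻ x, expNeg (a * x) ∂P.map (fun ω => N ω A) := by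
        rw [hlaw A hA, lintegral_expNeg_mul_poissonLaw]
    _ = ∫⁻ ω, expNeg (a * N ω A) ∂P :=
        lintegral_map (measurable_expNeg.comp (measurable_id.const_mul _))
          ((Measure.measurable_coe hA).comp hN)
    _ = expNeg (a * m.1 A + ∫⁻ μ : FinMeas S, (1 - expNeg (a * μ.1 A)) ∂lam) := hlaplace A hA a

end RandomMeasure

theorem mainTheorem9 {E Ω : Type*} [MeasurableSpace Ω] (P : Measure Ω) [IsProbabilityMeasure P]
    (N : Ω → Measure (E → ℝ≥0)) (ν : Measure (E → ℝ≥0)) (lam : Measure (FinMeas (E → ℝ≥0)))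
    (hN : IsPoissonRandomMeasure P N ν) (hlam : IsLevyMeasure P N lam) :
    ν = lam.bind (fun μ => μ.1) := by
  obtain ⟨m, hm⟩ := hlam.exists_laplace_apply
  exact mainTheorem9_general hN.measurable hN.law m hm
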